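/- Let $\mathbb{F}_\infty$ be the free group on countably many generators $g_0, g_1, g_2, \dots$, with identity $e$. Every $g \in \mathbb{F}_\infty$ has a unique reduced form $g = g_{i_1}^{k_1} g_{i_2}^{k_2} \cdots g_{i_n}^{k_n}$ with $n \ge 0$, $k_j \in \mathbb{Z}\setminus\{0\}$ and $i_j \ne i_{j+1}$; its $\ell^2$ length is $\|g\|_2 = \bigl(\sum_{j=1}^n |k_j|^2\bigr)^{1/2}$, so $\|g\|_2^2$ is a natural number (and $\|e\|_2 = 0$). A function $\varphi : \mathbb{F}_\infty \to \mathbb{C}$ is called positive definite if for all $n \in \mathbb{N}$, $x_1, \dots, x_n \in \mathbb{F}_\infty$ and $c_1, \dots, c_n \in \mathbb{C}$ the number $\sum_{j,k=1}^n c_j \overline{c_k}\, \varphi(x_j^{-1} x_k)$ is real and nonnegative. It is called $\|\cdot\|_2$-radial if $\varphi(g)$ depends only on $\|g\|_2$. **Theorem.** Let $\varphi : \mathbb{F}_\infty \to \mathbb{C}$ be $\|\cdot\|_2$-radial with $\varphi(e) = 1$. Then the following are equivalent: 1. $\varphi$ is positive definite on $\mathbb{F}_\infty$. 2. There is a Borel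 probability measure $\mu$ on $[-1,1]$ such that $$\varphi(g) = \int_{[-1,1]} s^{\|g\|_2^2}\, d\mu(s) \quad \text{for all } g \in \mathbb{F}_\infty,$$ where $s^0 = 1$ for every $s$, including $s = 0$. Moreover, if (2) holds, then $\mu$ is uniquely determined by $\varphi$. -/

import Mathlib

/-- The homomorphism from the free group on generators `g_0, g_1, …` to the free product of
countably many copies of `ℤ` (written multiplicatively) that sends `g_i` to the generator of the
`i`-th factor. -/
def freeGroupToCoprod : FreeGroup ℕ →* Monoid.CoprodI (fun _ : ℕ => Multiplicative ℤ) :=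
  FreeGroup.lift fun i =>
    Monoid.CoprodI.of (M := fun _ : ℕ => Multiplicative ℤ) (i := i) (Multiplicative.ofAdd 1)

/-- The list `[(i_1, k_1), …, (i_n, k_n)]` of generators and exponents in the reduced form
`g = g_{i_1}^{k_1} ⋯ g_{i_n}^{k_n}`. It is the only list with this product that satisfies
`IsReducedBlocks`: see `isReducedBlocks_blocks`, `blockProd_blocks` and `blocks_blockProd`. -/
def blocks (g : FreeGroup ℕ) : List (ℕ × ℤ) :=
  (Monoid.CoprodI.Word.equiv (freeGroupToCoprod g)).toList.map fun b => (b.1, b.2.toAdd)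

/-- A list of blocks is reduced if all exponents are nonzero and neighbouring blocks have
different generators. -/
def IsReducedBlocks (L : List (ℕ × ℤ)) : Prop :=
  (∀ b ∈ L, b.2 ≠ 0) ∧ L.IsChain fun a b => a.1 ≠ b.1

/-- The element `g_{i_1}^{k_1} ⋯ g_{i_n}^{k_n}` of the free group. -/
def blockProd (L : List (ℕ × ℤ)) : FreeGroup ℕ :=
  (L.map fun b => FreeGroup.of b.1 ^ b.2).prod

/-- `‖g‖₂² = ∑ |k_j|²`, a natural number. -/
def l2LengthSq (g : FreeGroup ℕ) : ℕ :=
  ((blocks g).map fun b => b.2.natAbs ^ 2).sum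

/-- The `ℓ²` length `‖g‖₂ = (∑ |k_j|²)^{1/2}`. -/
noncomputable def l2Length (g : FreeGroup ℕ) : ℝ :=
  Real.sqrt (l2LengthSq g)

/-- `φ` is `‖·‖₂`-radial: its value at `g` depends only on `‖g‖₂`. -/
def IsL2Radial (φ : FreeGroup ℕ → ℂ) : Prop :=
  ∀ g h : FreeGroup ℕ, l2Length g = l2Length h → φ g = φ h

open scoped ComplexOrder in
/-- Positive definite functions on a group. In the order of `ℂ` used here, `0 ≤ z` says that `z` is
real and nonnegative. -/
def IsPositiveDefinite {G : Type*} [Group G] (φ : G → ℂ) : Prop :=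
  ∀ (n : ℕ) (x : Fin n → G) (c : Fin n → ℂ),
    0 ≤ ∑ j, ∑ k, c j * (starRingEnd ℂ) (c k) * φ ((x j)⁻¹ * x k)

/-- `φ(g) = ∫_{[-1,1]} s^{‖g‖₂²} dμ(s)` for all `g`. -/
def IsL2Representing (μ : MeasureTheory.ProbabilityMeasure (Set.Icc (-1 : ℝ) 1))
    (φ : FreeGroup ℕ → ℂ) : Prop :=
  ∀ g : FreeGroup ℕ,
    φ g = ((∫ s : Set.Icc (-1 : ℝ) 1, (s : ℝ) ^ l2LengthSq g
      ∂(μ : MeasureTheory.Measure (Set.Icc (-1 : ℝ) 1)) : ℝ) : ℂ)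

/-- The exponent of the integrand is the square of the `ℓ²` length. -/
theorem l2Length_sq (g : FreeGroup ℕ) : l2Length g ^ 2 = l2LengthSq g :=
  Real.sq_sqrt (Nat.cast_nonneg _)

/-- The homomorphism back from the free product to the free group. -/
def coprodToFreeGroup : Monoid.CoprodI (fun _ : ℕ => Multiplicative ℤ) →* FreeGroup ℕ :=
  Monoid.CoprodI.lift fun i => zpowersHom (FreeGroup ℕ) (FreeGroup.of i)

theorem coprodToFreeGroup_freeGroupToCoprod (g : FreeGroup ℕ) :
    coprodToFreeGroup (freeGroupToCoprod g) = g := by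
  have : coprodToFreeGroup.comp freeGroupToCoprod = MonoidHom.id _ := by
    ext i
    simp [coprodToFreeGroup, freeGroupToCoprod]
  exact DFunLike.congr_fun this g

theorem isReducedBlocks_blocks (g : FreeGroup ℕ) : IsReducedBlocks (blocks g) := by
  refine ⟨?_, ?_⟩
  · intro b hb
    obtain ⟨a, ha, rfl⟩ := List.mem_map.1 hb
    exact fun h => (Monoid.CoprodI.Word.equiv (freeGroupToCoprod g)).ne_one a ha h
  · unfold blocks
    rw [List.isChain_map]
    exact (Monoid.CoprodI.Word.equiv (freeGroupToCoprod g)).chain_ne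

theorem blockProd_blocks (g : FreeGroup ℕ) : blockProd (blocks g) = g := by
  have h1 : Monoid.CoprodI.Word.prod (Monoid.CoprodI.Word.equiv (freeGroupToCoprod g)) = freeGroupToCoprod g :=
    Monoid.CoprodI.Word.equiv.left_inv _
  conv_rhs => rw [← coprodToFreeGroup_freeGroupToCoprod g, ← h1]
  simp only [Monoid.CoprodI.Word.prod, map_list_prod, blockProd, blocks, List.map_map]
  refine congrArg List.prod (List.map_congr_left fun a _ => ?_)
  simp [coprodToFreeGroup, zpowersHom_apply]

theorem blocks_blockProd (L : List (ℕ × ℤ)) (hL : IsReducedBlocks L) :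
    blocks (blockProd L) = L := by
  let w : Monoid.CoprodI.Word (fun _ : ℕ => Multiplicative ℤ) :=
    { toList := L.map fun b => ⟨b.1, Multiplicative.ofAdd b.2⟩
      ne_one := by
        intro a ha
        obtain ⟨b, hb, rfl⟩ := List.mem_map.1 ha
        exact fun h => hL.1 b hb h
      chain_ne := by
        rw [List.isChain_map]
        exact hL.2 }
  have hw : freeGroupToCoprod (blockProd L) = w.prod := by
    simp only [Monoid.CoprodI.Word.prod, map_list_prod, blockProd, List.map_map, w]
    refine congrArg List.prod (List.map_congr_left fun a _ => ?_)
    have h : FreeGroup.lift (fun i => Monoid.CoprodI.of (M := fun _ : ℕ => Multiplicative ℤ) (i := i)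
        (Multiplicative.ofAdd 1)) (FreeGroup.of a.1) =
        Monoid.CoprodI.of (M := fun _ : ℕ => Multiplicative ℤ) (i := a.1) (Multiplicative.ofAdd 1) :=
      FreeGroup.lift_apply_of
    simp only [Function.comp, freeGroupToCoprod]
    rw [map_zpow, h, ← map_zpow, ← ofAdd_zsmul]
    simp
  have h2 : Monoid.CoprodI.Word.equiv (freeGroupToCoprod (blockProd L)) = w := by
    rw [hw]
    exact Monoid.CoprodI.Word.equiv.right_inv w
  unfold blocks
  rw [h2]
  simp [w, Function.comp_def]

/-! From measure to function, it suffices that `s ^ ‖x⁻¹y‖₂²` is a positive semidefinite kernel for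
each `|s| ≤ 1`. After cancellation of the common prefix, the next blocks of `x` and `y` either stay
apart or, on a common generator, merge with exponent `b - a`. So the kernel is a rank one kernel
plus a sum over prefixes of terms built from `sqKernel`, which is positive semidefinite on `ℤ`
(`posSemidef_sqKernel`, `pow_l2LengthSq_inv_mul`).

Conversely, `φ g = f (‖g‖₂²)` with `f` real and `|f| ≤ 1`. Take `N` words of squared length `n` for
each `n < D`, with no cancellation between different words. Their kernel is `f (n + m)` off the
diagonal, and the diagonal contributes only order `N` against `N²`; hence `f` has nonnegative Hankel
forms (`sum_hankel_nonneg_of_isPositiveDefinite`). The functional `X ^ n ↦ f n` is then nonnegative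
on squares, by boundedness also on `(1 - X²) q²`, and by factorization on every polynomial
nonnegative on `[-1, 1]`. Riesz extension and Riesz–Markov–Kakutani yield the measure. It is unique
because every `n` is a squared length, so `φ` fixes all moments. -/

open Filter Topology Matrix

/-! ### Positive semidefinite kernels, and the Gaussian-type kernel on `ℤ` -/

namespace Matrix

variable {X Y : Type*}

theorem posSemidef_of_tendsto {ι : Type*} {l : Filter ι} [l.NeBot] {A : ι → Matrix X X ℝ}
    {B : Matrix X X ℝ} (hA : ∀ᶠ i in l, (A i).PosSemidef)
    (h : ∀ x y, Tendsto (fun i => A i x y) l (𝓝 (B x y))) : B.PosSemidef := by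
  refine ⟨?_, fun c => ?_⟩
  · ext x y
    refine tendsto_nhds_unique (f := fun i => A i y x) (h y x) ((h x y).congr' ?_)
    filter_upwards [hA] with i hi
    simpa using congrFun (congrFun hi.1 y) x
  · refine ge_of_tendsto (tendsto_finsetSum _ fun x _ => tendsto_finsetSum _ fun y _ =>
      ((h x y).const_mul (star (c x))).mul_const (c y)) ?_
    filter_upwards [hA] with i hi
    exact hi.2 c

theorem posSemidef_vecMulVec_self (v : X → ℝ) : (vecMulVec v v).PosSemidef := by
  refine ⟨?_, fun c => ?_⟩
  · ext x y
    simp [vecMulVec_apply, mul_comm]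
  · have : (c.sum fun x a => c.sum fun y b => star a * vecMulVec v v x y * b)
        = (c.sum fun x a => a * v x) ^ 2 := by
      simp only [Finsupp.sum, sq, Finset.sum_mul_sum, vecMulVec_apply, star_trivial]
      exact Finset.sum_congr rfl fun x _ => Finset.sum_congr rfl fun y _ => by ring
    rw [this]
    positivity

theorem PosSemidef.congr {A B : Matrix X X ℝ} (hA : A.PosSemidef) (h : ∀ x y, B x y = A x y) :
    B.PosSemidef :=
  (Matrix.ext h : B = A) ▸ hA

theorem PosSemidef.mul_entries {A B : Matrix X X ℝ} (hA : A.PosSemidef) (hB : B.PosSemidef) :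
    (of fun x y => A x y * B x y).PosSemidef :=
  PosSemidef.hadamard (𝕜 := ℝ) hA hB

theorem posSemidef_indicator_eq [DecidableEq Y] (e : X → Y) :
    (of fun x y => if e x = e y then (1 : ℝ) else 0).PosSemidef :=
  ((PosSemidef.one (n := Y) (R := ℝ)).submatrix e).congr fun _ _ => (one_apply ..).symm

/-- Without its constant term, the exponential series is still a nonnegative combination of the rank
one kernels of `v ^ m`. -/
theorem posSemidef_exp_sub_one {t : ℝ} (ht : 0 ≤ t) (v : X → ℝ) :
    (of fun x y => Real.exp (t * (v x * v y)) - 1).PosSemidef := by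
  refine posSemidef_of_tendsto (l := atTop) (A := fun n : ℕ => ∑ m ∈ Finset.range n,
    (t ^ (m + 1) / (m + 1).factorial) • vecMulVec (fun x => v x ^ (m + 1)) fun x => v x ^ (m + 1))
    (Eventually.of_forall fun n => posSemidef_sum _ fun m _ =>
      (posSemidef_vecMulVec_self _).smul (by positivity)) fun x y => ?_
  have h : HasSum (fun m : ℕ => (t * (v x * v y)) ^ m / m.factorial)
      (Real.exp (t * (v x * v y))) := by
    rw [Real.exp_eq_exp_ℝ]
    exact NormedSpace.expSeries_div_hasSum_exp _
  have h' := ((hasSum_nat_add_iff' 1).2 h).tendsto_sum_nat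
  simp only [Finset.range_one, Finset.sum_singleton, pow_zero, Nat.factorial_zero, Nat.cast_one,
    div_one] at h'
  refine h'.congr fun n => ?_
  simp only [sum_apply, smul_apply, vecMulVec_apply, smul_eq_mul, mul_pow]
  exact Finset.sum_congr rfl fun m _ => by ring

/-- The Schur complement at `0` of the kernel `s ^ (a - b)²` on `ℤ`. -/
def sqKernel (s : ℝ) : Matrix ℤ ℤ ℝ :=
  of fun a b => s ^ ((a - b).natAbs ^ 2) - s ^ (a.natAbs ^ 2) * s ^ (b.natAbs ^ 2)

/-- As `(a - b)² = a² + b² - 2ab`, the kernel is `s ^ a² * s ^ b² * (exp (t a b) - 1)` with `t = -2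
log s ≥ 0`. -/
theorem posSemidef_sqKernel_of_pos {s : ℝ} (h0 : 0 < s) (h1 : s ≤ 1) :
    (sqKernel s).PosSemidef := by
  have key : ∀ k : ℤ, s ^ (k.natAbs ^ 2) = Real.exp (Real.log s * (k : ℝ) ^ 2) := fun k => by
    rw [← Real.rpow_natCast, Real.rpow_def_of_pos h0]
    push_cast
    rw [Nat.cast_natAbs, Int.cast_abs, sq_abs]
  have := (posSemidef_vecMulVec_self fun a : ℤ => s ^ (a.natAbs ^ 2)).mul_entries
    (posSemidef_exp_sub_one (t := -2 * Real.log s) (by nlinarith [Real.log_nonpos h0.le h1])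
      fun a : ℤ => (a : ℝ))
  refine this.congr fun a b => ?_
  simp only [sqKernel, of_apply, vecMulVec_apply, key, mul_sub, mul_one,
    ← Real.exp_add]
  push_cast
  ring_nf

/-- Since `k²` and `k` have the same parity, `(-1) ^ k²` is a character of `ℤ`, so a negative `s`
only twists the kernel of `|s|` by a rank one sign. The case `s = 0` is a limit from the right. -/
theorem posSemidef_sqKernel {s : ℝ} (hs : |s| ≤ 1) : (sqKernel s).PosSemidef := by
  rcases lt_trichotomy s 0 with h | rfl | h
  · have hr := posSemidef_sqKernel_of_pos (abs_pos.2 h.ne) hs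
    have hpar : ∀ a b : ℤ, (-1 : ℝ) ^ ((a - b).natAbs ^ 2)
        = (-1) ^ (a.natAbs ^ 2) * (-1) ^ (b.natAbs ^ 2) := fun a b => by
      rw [← pow_add]
      refine neg_one_pow_congr ?_
      simp [Nat.even_add, Nat.even_pow, Int.natAbs_even, Int.even_sub]
    have hpow : ∀ n : ℕ, s ^ n = (-1) ^ n * |s| ^ n := fun n => by
      rw [← mul_pow, abs_of_neg h]
      simp
    refine (hr.mul_entries (posSemidef_vecMulVec_self
      fun a : ℤ => (-1 : ℝ) ^ (a.natAbs ^ 2))).congr fun a b => ?_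
    simp only [sqKernel, of_apply, vecMulVec_apply, hpow, hpar]
    ring
  · refine posSemidef_of_tendsto (l := 𝓝[>] (0 : ℝ)) (A := sqKernel) ?_ fun a b => ?_
    · filter_upwards [Ioc_mem_nhdsGT (zero_lt_one (α := ℝ))] with s hs
      exact posSemidef_sqKernel_of_pos hs.1 hs.2
    · have : Continuous fun s => sqKernel s a b := by
        simp only [sqKernel, of_apply]
        fun_prop
      exact (this.tendsto 0).mono_left nhdsWithin_le_nhds
  · exact posSemidef_sqKernel_of_pos h ((le_abs_self s).trans hs)

end Matrix

/-! ### Blocks of inverses and of products without cancellation -/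

/-- The sum `∑ |k_j|²` of a list of blocks. -/
def sqSum (L : List (ℕ × ℤ)) : ℕ :=
  (L.map fun b => b.2.natAbs ^ 2).sum

@[simp]
theorem sqSum_nil : sqSum [] = 0 := rfl

@[simp]
theorem sqSum_cons (b : ℕ × ℤ) (L : List (ℕ × ℤ)) : sqSum (b :: L) = b.2.natAbs ^ 2 + sqSum L := by
  simp [sqSum]

@[simp]
theorem sqSum_append (L M : List (ℕ × ℤ)) : sqSum (L ++ M) = sqSum L + sqSum M := by
  simp [sqSum]

@[simp]
theorem blockProd_cons (b : ℕ × ℤ) (L : List (ℕ × ℤ)) :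
    blockProd (b :: L) = FreeGroup.of b.1 ^ b.2 * blockProd L := by
  simp [blockProd]

theorem l2LengthSq_blockProd {L : List (ℕ × ℤ)} (hL : IsReducedBlocks L) :
    l2LengthSq (blockProd L) = sqSum L := by
  rw [l2LengthSq, blocks_blockProd L hL, sqSum]

theorem l2LengthSq_eq_sqSum_blocks (g : FreeGroup ℕ) : l2LengthSq g = sqSum (blocks g) := rfl

theorem isReducedBlocks_nil : IsReducedBlocks [] := by
  simp [IsReducedBlocks]

theorem isReducedBlocks_cons {b : ℕ × ℤ} {L : List (ℕ × ℤ)} :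
    IsReducedBlocks (b :: L) ↔ b.2 ≠ 0 ∧ (∀ a ∈ L.head?, b.1 ≠ a.1) ∧ IsReducedBlocks L := by
  simp only [IsReducedBlocks, List.forall_mem_cons, List.isChain_cons]
  tauto

/-- The blocks of the inverse. -/
def blockInv (L : List (ℕ × ℤ)) : List (ℕ × ℤ) :=
  (L.map fun b => (b.1, -b.2)).reverse

theorem blockProd_blockInv (L : List (ℕ × ℤ)) : blockProd (blockInv L) = (blockProd L)⁻¹ := by
  simp [blockProd, blockInv, List.prod_inv_reverse, Function.comp_def]

theorem sqSum_blockInv (L : List (ℕ × ℤ)) : sqSum (blockInv L) = sqSum L := by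
  simp [sqSum, blockInv, List.sum_reverse, Function.comp_def]

theorem IsReducedBlocks.blockInv_append {L M : List (ℕ × ℤ)} (hL : IsReducedBlocks L)
    (hM : IsReducedBlocks M) (h : ∀ a ∈ L.head?, ∀ b ∈ M.head?, a.1 ≠ b.1) :
    IsReducedBlocks (blockInv L ++ M) := by
  refine ⟨fun b hb => ?_, ?_⟩
  · rcases List.mem_append.1 hb with hb | hb
    · obtain ⟨a, ha, rfl⟩ := List.mem_map.1 (List.mem_reverse.1 hb)
      simpa using hL.1 a ha
    · exact hM.1 b hb
  · rw [List.isChain_append]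
    refine ⟨?_, hM.2, ?_⟩
    · rw [blockInv, List.isChain_reverse, List.isChain_map]
      exact hL.2.imp fun _ _ h => h.symm
    · intro x hx b hb
      rw [blockInv, List.getLast?_reverse, List.head?_map] at hx
      obtain ⟨a, ha, rfl⟩ := Option.mem_map.1 hx
      exact h a ha b hb

theorem l2LengthSq_inv_mul {L M : List (ℕ × ℤ)} (hL : IsReducedBlocks L)
    (hM : IsReducedBlocks M) (h : ∀ a ∈ L.head?, ∀ b ∈ M.head?, a.1 ≠ b.1) :
    l2LengthSq ((blockProd L)⁻¹ * blockProd M) = sqSum L + sqSum M := by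
  have : (blockProd L)⁻¹ * blockProd M = blockProd (blockInv L ++ M) := by
    rw [← blockProd_blockInv]
    simp [blockProd]
  rw [this, l2LengthSq_blockProd (hL.blockInv_append hM h), sqSum_append, sqSum_blockInv]

theorem l2LengthSq_inv (g : FreeGroup ℕ) : l2LengthSq g⁻¹ = l2LengthSq g := by
  have := l2LengthSq_inv_mul (isReducedBlocks_blocks g) isReducedBlocks_nil (by simp)
  rw [blockProd_blocks] at this
  simpa [blockProd, l2LengthSq_eq_sqSum_blocks] using this

@[simp]
theorem l2LengthSq_one : l2LengthSq 1 = 0 :=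
  l2LengthSq_blockProd isReducedBlocks_nil

/-! ### Positive semidefiniteness of `s ^ ‖x⁻¹y‖₂²` -/

/-- The part of the kernel `s ^ ‖x⁻¹ y‖₂²` that comes from the first `n` blocks, after the rank one
kernel `s ^ ‖x‖₂² * s ^ ‖y‖₂²` is removed. -/
noncomputable def prefixKernel (s : ℝ) : ℕ → Matrix (List (ℕ × ℤ)) (List (ℕ × ℤ)) ℝ
  | 0 => 0
  | n + 1 => of fun x y =>
      (if x.head?.map Prod.fst = y.head?.map Prod.fst then 1 else 0) *
        -- The default exponent `0` makes this term vanish on empty words, because row and column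
        -- `0` of `sqKernel` are zero.
        (sqKernel s (x.head?.elim 0 Prod.snd) (y.head?.elim 0 Prod.snd) *
          (s ^ sqSum x.tail * s ^ sqSum y.tail)) +
      (if x.head? = y.head? then 1 else 0) * prefixKernel s n x.tail y.tail

theorem posSemidef_prefixKernel {s : ℝ} (hs : |s| ≤ 1) (n : ℕ) : (prefixKernel s n).PosSemidef := by
  induction n with
  | zero => exact PosSemidef.zero
  | succ n ih =>
    refine PosSemidef.add (A := of fun x y => _) (B := of fun x y => _)
      (PosSemidef.mul_entries (posSemidef_indicator_eq fun x : List (ℕ × ℤ) => x.head?.map Prod.fst)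
        (PosSemidef.mul_entries
          ((posSemidef_sqKernel hs).submatrix fun x : List (ℕ × ℤ) => x.head?.elim 0 Prod.snd)
          (posSemidef_vecMulVec_self fun x : List (ℕ × ℤ) => s ^ sqSum x.tail)))
      (PosSemidef.mul_entries (posSemidef_indicator_eq fun x : List (ℕ × ℤ) => x.head?)
        (ih.submatrix List.tail))

@[simp]
theorem prefixKernel_nil_left (s : ℝ) (n : ℕ) (y : List (ℕ × ℤ)) : prefixKernel s n [] y = 0 := by
  induction n generalizing y with
  | zero => rfl
  | succ n ih => simp [prefixKernel, sqKernel, ih]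

@[simp]
theorem prefixKernel_nil_right (s : ℝ) (n : ℕ) (x : List (ℕ × ℤ)) : prefixKernel s n x [] = 0 := by
  induction n generalizing x with
  | zero => rfl
  | succ n ih => simp [prefixKernel, sqKernel, ih]

/-- Different first generators leave only the rank one term. A common generator with exponents `a ≠
b` adds the `sqKernel` term. Equal first blocks cancel and recurse, and `1 - s ^ (2a²)` from
`sqKernel` restores the rank one term of the tails. -/
theorem pow_l2LengthSq_inv_mul (s : ℝ) {n : ℕ} {x y : List (ℕ × ℤ)} (hx : IsReducedBlocks x)
    (hy : IsReducedBlocks y) (hn : x.length ≤ n) :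
    s ^ l2LengthSq ((blockProd x)⁻¹ * blockProd y)
      = s ^ sqSum x * s ^ sqSum y + prefixKernel s n x y := by
  induction n generalizing x y with
  | zero =>
    obtain rfl := List.length_eq_zero_iff.1 (Nat.le_zero.1 hn)
    rw [l2LengthSq_inv_mul hx hy (by simp), prefixKernel_nil_left, pow_add, add_zero]
  | succ n ih =>
    rcases x with _ | ⟨⟨i, a⟩, x⟩
    · rw [l2LengthSq_inv_mul hx hy (by simp), prefixKernel_nil_left, pow_add, add_zero]
    rcases y with _ | ⟨⟨j, b⟩, y⟩
    · rw [l2LengthSq_inv_mul hx hy (by simp), prefixKernel_nil_right, pow_add, add_zero]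
    by_cases hij : i = j
    · subst hij
      obtain ⟨-, hix, hx'⟩ := isReducedBlocks_cons.1 hx
      obtain ⟨-, hiy, hy'⟩ := isReducedBlocks_cons.1 hy
      by_cases hab : a = b
      · subst hab
        have h1 : (blockProd ((i, a) :: x))⁻¹ * blockProd ((i, a) :: y)
            = (blockProd x)⁻¹ * blockProd y := by
          simp [mul_assoc]
        rw [h1, ih hx' hy' (by simpa using hn)]
        simp [prefixKernel, sqKernel, pow_add]
        ring
      · have h1 : (blockProd ((i, a) :: x))⁻¹ * blockProd ((i, b) :: y)
            = (blockProd x)⁻¹ * blockProd ((i, b - a) :: y) := by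
          simp only [blockProd_cons, _root_.mul_inv_rev, sub_eq_neg_add, _root_.zpow_add,
            _root_.zpow_neg, mul_assoc]
        have hb : IsReducedBlocks ((i, b - a) :: y) :=
          isReducedBlocks_cons.2 ⟨sub_ne_zero.2 (Ne.symm hab), hiy, hy'⟩
        rw [h1, l2LengthSq_inv_mul hx' hb fun c hc d hd => by
          obtain rfl : (i, b - a) = d := by simpa using hd
          exact (hix c hc).symm]
        simp [prefixKernel, sqKernel, pow_add, hab, ← Int.natAbs_neg (b - a)]
        ring
    · rw [l2LengthSq_inv_mul hx hy (by simpa using hij), pow_add]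
      simp [prefixKernel, hij]

theorem posSemidef_pow_l2LengthSq {s : ℝ} (hs : |s| ≤ 1) {ι : Type*} [Fintype ι]
    (x : ι → FreeGroup ℕ) :
    (of fun j k => s ^ l2LengthSq ((x j)⁻¹ * x k)).PosSemidef := by
  refine PosSemidef.congr (PosSemidef.add
    (posSemidef_vecMulVec_self fun j => s ^ sqSum (blocks (x j)))
    -- The total length is one recursion depth that suffices for all the words at once.
    ((posSemidef_prefixKernel hs (∑ j, (blocks (x j)).length)).submatrix fun j => blocks (x j)))
    fun j k => ?_
  have := pow_l2LengthSq_inv_mul s (isReducedBlocks_blocks (x j)) (isReducedBlocks_blocks (x k))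
    (Finset.single_le_sum (fun i _ => Nat.zero_le (blocks (x i)).length) (Finset.mem_univ j))
  rw [blockProd_blocks, blockProd_blocks] at this
  exact this

/-! ### Polynomials positive on `[-1, 1]` -/

open Polynomial in
/-- The semiring of polynomials generated by the squares, `1 - X` and `1 + X`. -/
noncomputable def intervalCone : Subsemiring ℝ[X] :=
  Subsemiring.closure ({p | ∃ q, p = q ^ 2} ∪ {1 - X, 1 + X})

namespace Polynomial

theorem sq_mem_intervalCone (q : ℝ[X]) : q ^ 2 ∈ intervalCone :=
  Subsemiring.subset_closure (Or.inl ⟨q, rfl⟩)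

theorem C_mem_intervalCone {c : ℝ} (hc : 0 ≤ c) : C c ∈ intervalCone := by
  have := sq_mem_intervalCone (C √c)
  rwa [← C_pow, Real.sq_sqrt hc] at this

theorem mem_intervalCone_of_natDegree_le_one {p : ℝ[X]} (hp : p.natDegree ≤ 1)
    (hpos : ∀ x ∈ Set.Icc (-1 : ℝ) 1, 0 < p.eval x) : p ∈ intervalCone := by
  obtain ⟨a, b, rfl⟩ := exists_eq_X_add_C_of_natDegree_le_one hp
  have h1 := hpos 1 (by simp)
  have h2 := hpos (-1) (by simp)
  simp only [eval_add, eval_mul, eval_C, eval_X] at h1 h2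
  -- Linear interpolation between the values `b - a` at `-1` and `b + a` at `1`.
  have : C a * X + C b = C ((b - a) / 2) * (1 - X) + C ((b + a) / 2) * (1 + X) := by
    refine funext fun z => ?_
    simp only [eval_add, eval_sub, eval_mul, eval_C, eval_X, eval_one]
    ring
  rw [this]
  exact add_mem
    (mul_mem (C_mem_intervalCone (by linarith)) (Subsemiring.subset_closure (by simp)))
    (mul_mem (C_mem_intervalCone (by linarith)) (Subsemiring.subset_closure (by simp)))

theorem eval_pos_of_no_root {p : ℝ[X]} {s : Set ℝ} (hs : s.OrdConnected) {x y : ℝ} (hx : x ∈ s)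
    (hy : y ∈ s) (hroot : ∀ z ∈ s, p.eval z ≠ 0) (h : 0 < p.eval x) : 0 < p.eval y := by
  by_contra! hle
  obtain ⟨z, hz, hz0⟩ := hs.isPreconnected.intermediate_value hy hx
    (f := fun z => p.eval z) p.continuous.continuousOn ⟨hle, h.le⟩
  exact hroot z hz hz0

theorem mem_intervalCone_of_irreducible {p : ℝ[X]} (hirr : Irreducible p)
    (hpos : ∀ x ∈ Set.Icc (-1 : ℝ) 1, 0 < p.eval x) : p ∈ intervalCone := by
  rcases Nat.lt_or_ge 1 p.natDegree with hdeg | hdeg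
  · have hroot : ∀ z, p.eval z ≠ 0 := fun z hz => by
      have := degree_eq_one_of_irreducible_of_root hirr hz
      have : p.natDegree = 1 := natDegree_eq_of_degree_eq_some this
      omega
    have hev : ∀ z, 0 < p.eval z := fun z =>
      eval_pos_of_no_root Set.ordConnected_univ (Set.mem_univ 0) (Set.mem_univ z)
        (fun z _ => hroot z) (hpos 0 (by simp))
    obtain ⟨a, b, c, hp⟩ : ∃ a b c : ℝ, p = C a * X ^ 2 + C b * X + C c :=
      ⟨_, _, _, eq_quadratic_of_degree_le_two hirr.degree_le_two⟩
    have hval : ∀ z, 0 < a * z ^ 2 + b * z + c := fun z => by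
      simpa [hp] using hev z
    have ha : 0 < a := by
      have hane : a ≠ 0 := by
        rintro rfl
        have : p.natDegree ≤ 1 := by
          rw [hp, C_0, zero_mul, zero_add]
          exact natDegree_linear_le
        omega
      have hd := discrim_le_zero (a := a) (b := b) (c := c)
        fun z => by nlinarith [hval z]
      have hc := hval 0
      rw [discrim] at hd
      by_contra! hle
      have : a < 0 := lt_of_le_of_ne hle hane
      nlinarith [sq_nonneg b]
    -- After completing the square, the remaining constant is the value at the vertex, hence
    -- positive.
    have hsplit : p = C a * (X + C (b / (2 * a))) ^ 2 + C (c - b ^ 2 / (4 * a)) := by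
      refine funext fun z => ?_
      simp only [hp, eval_add, eval_mul, eval_C, eval_X, eval_pow]
      field_simp
      ring
    rw [hsplit]
    refine add_mem (mul_mem (C_mem_intervalCone ha.le) (sq_mem_intervalCone _))
      (C_mem_intervalCone ?_)
    have := hval (-(b / (2 * a)))
    have h2 : a * (-(b / (2 * a))) ^ 2 + b * (-(b / (2 * a))) + c = c - b ^ 2 / (4 * a) := by
      field_simp
      ring
    linarith
  · exact mem_intervalCone_of_natDegree_le_one hdeg hpos

/-- Strict positivity keeps roots out of the interval, so an irreducible factor has constant sign
there. Normalizing that sign at `0` makes both factors positive, and the degree drops. -/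
theorem mem_intervalCone_of_pos {p : ℝ[X]} (hpos : ∀ x ∈ Set.Icc (-1 : ℝ) 1, 0 < p.eval x) :
    p ∈ intervalCone := by
  induction hn : p.natDegree using Nat.strong_induction_on generalizing p with
  | _ n ih =>
    subst hn
    rcases Nat.eq_zero_or_pos p.natDegree with h0 | h0
    · exact mem_intervalCone_of_natDegree_le_one (by omega) hpos
    have hp0 : p ≠ 0 := by
      rintro rfl
      simp at h0
    obtain ⟨q, hq, r, hr⟩ := exists_irreducible_of_natDegree_pos h0
    wlog hq0 : 0 < q.eval 0 generalizing q r
    · refine this (-q) ((Associated.refl q).neg_right.irreducible hq) (-r) (by rw [hr]; ring) ?_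
      have := hpos 0 (by simp)
      rw [hr, eval_mul] at this
      rw [eval_neg]
      have : q.eval 0 ≠ 0 := left_ne_zero_of_mul this.ne'
      push Not at hq0
      exact neg_pos.2 (lt_of_le_of_ne hq0 this)
    have hqpos : ∀ x ∈ Set.Icc (-1 : ℝ) 1, 0 < q.eval x := fun x hx =>
      eval_pos_of_no_root Set.ordConnected_Icc (by simp) hx (fun z hz h => by
        have := hpos z hz
        rw [hr, eval_mul, h, zero_mul] at this
        exact lt_irrefl _ this) hq0
    have hrpos : ∀ x ∈ Set.Icc (-1 : ℝ) 1, 0 < r.eval x := fun x hx => by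
      have := hpos x hx
      rw [hr, eval_mul] at this
      exact pos_of_mul_pos_right this (hqpos x hx).le
    have hdeg : r.natDegree < p.natDegree := by
      have := hq.natDegree_pos
      rw [hr] at hp0
      rw [hr, natDegree_mul (left_ne_zero_of_mul hp0) (right_ne_zero_of_mul hp0)]
      omega
    rw [hr]
    exact mul_mem (mem_intervalCone_of_irreducible hq hqpos) (ih _ hdeg hrpos rfl)

/-! ### Functionals nonnegative on squares with bounded moments -/

section functional

variable {L : ℝ[X] →ₗ[ℝ] ℝ}

theorem exists_abs_apply_X_pow_mul_le (hb : ∀ n, |L (X ^ n)| ≤ 1) (p : ℝ[X]) :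
    ∃ B, ∀ k, |L (X ^ k * p)| ≤ B := by
  induction p using Polynomial.induction_on' with
  | add p q hp hq =>
    obtain ⟨B, hB⟩ := hp
    obtain ⟨B', hB'⟩ := hq
    refine ⟨B + B', fun k => ?_⟩
    rw [mul_add, map_add]
    exact (abs_add_le _ _).trans (add_le_add (hB k) (hB' k))
  | monomial n a =>
    refine ⟨|a|, fun k => ?_⟩
    have : X ^ k * monomial n a = a • X ^ (k + n) := by
      rw [← smul_X_eq_monomial, mul_smul_comm, pow_add]
    rw [this, map_smul, smul_eq_mul, abs_mul]
    exact mul_le_of_le_one_right (abs_nonneg a) (hb _)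

/-- The sequence `L (X ^ (2k) * q²)` is convex, its second differences being values of `L` at
squares. A convex sequence that is bounded above cannot increase. -/
theorem apply_one_sub_X_sq_mul_sq_nonneg (hsq : ∀ q, 0 ≤ L (q ^ 2)) (hb : ∀ n, |L (X ^ n)| ≤ 1)
    (q : ℝ[X]) : 0 ≤ L ((1 - X ^ 2) * q ^ 2) := by
  obtain ⟨B, hB⟩ := exists_abs_apply_X_pow_mul_le hb (q ^ 2)
  set d : ℕ → ℝ := fun k => L (X ^ (2 * k) * q ^ 2) with hd
  have hconv : ∀ k, d (k + 1) - d k ≤ d (k + 2) - d (k + 1) := fun k => by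
    have h := hsq (X ^ k * (1 - X ^ 2) * q)
    have : (X ^ k * (1 - X ^ 2) * q) ^ 2 = X ^ (2 * k) * q ^ 2 - X ^ (2 * (k + 1)) * q ^ 2
        - X ^ (2 * (k + 1)) * q ^ 2 + X ^ (2 * (k + 2)) * q ^ 2 := by ring
    rw [this, map_add, map_sub, map_sub] at h
    simp only [hd]
    linarith
  have hmono : Monotone fun k => d (k + 1) - d k := monotone_nat_of_le_succ hconv
  have hgrow : ∀ k : ℕ, d 0 + k * (d 1 - d 0) ≤ d k := fun k => by
    induction k with
    | zero => simp
    | succ k ih =>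
      have := hmono (Nat.zero_le k)
      push_cast
      simp only [zero_add] at this
      linarith
  have h01 : d 1 ≤ d 0 := by
    by_contra! hlt
    obtain ⟨k, hk⟩ := exists_nat_gt ((B - d 0) / (d 1 - d 0))
    rw [div_lt_iff₀ (sub_pos.2 hlt)] at hk
    have := (abs_le.1 (hB (2 * k))).2
    have := hgrow k
    simp only [hd] at *
    linarith
  have : (1 - X ^ 2) * q ^ 2 = X ^ (2 * 0) * q ^ 2 - X ^ (2 * 1) * q ^ 2 := by ring
  rw [this, map_sub]
  exact sub_nonneg.2 h01

/-- Even powers are absorbed into `q²`. The weights `1 ± X` reduce to `1 - X²` by `2 (1 ± X) = (1 ±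
X)² + (1 - X²)`. -/
theorem apply_sq_mul_pow_mul_pow_nonneg (hsq : ∀ q, 0 ≤ L (q ^ 2)) (hb : ∀ n, |L (X ^ n)| ≤ 1)
    (q : ℝ[X]) (i j : ℕ) : 0 ≤ L (q ^ 2 * (1 - X) ^ i * (1 + X) ^ j) := by
  have h2 := apply_one_sub_X_sq_mul_sq_nonneg hsq hb
  have half : ∀ p, 0 ≤ L ((2 : ℝ) • p) → 0 ≤ L p := fun p hp => by
    rw [map_smul, smul_eq_mul] at hp
    linarith
  have hm : ∀ q, 0 ≤ L ((1 - X) * q ^ 2) := fun q => half _ <| by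
    have : (2 : ℝ) • ((1 - X) * q ^ 2) = ((1 - X) * q) ^ 2 + (1 - X ^ 2) * q ^ 2 := by
      rw [ofNat_smul_eq_nsmul, nsmul_eq_mul]
      ring
    rw [this, map_add]
    exact add_nonneg (hsq _) (h2 q)
  have hp : ∀ q, 0 ≤ L ((1 + X) * q ^ 2) := fun q => half _ <| by
    have : (2 : ℝ) • ((1 + X) * q ^ 2) = ((1 + X) * q) ^ 2 + (1 - X ^ 2) * q ^ 2 := by
      rw [ofNat_smul_eq_nsmul, nsmul_eq_mul]
      ring
    rw [this, map_add]
    exact add_nonneg (hsq _) (h2 q)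
  obtain ⟨i, rfl | rfl⟩ := i.even_or_odd' <;> obtain ⟨j, rfl | rfl⟩ := j.even_or_odd'
  · convert hsq (q * (1 - X) ^ i * (1 + X) ^ j) using 2
    ring
  · convert hp (q * (1 - X) ^ i * (1 + X) ^ j) using 2
    ring
  · convert hm (q * (1 - X) ^ i * (1 + X) ^ j) using 2
    ring
  · convert h2 (q * (1 - X) ^ i * (1 + X) ^ j) using 2
    ring

theorem apply_nonneg_of_mem_intervalCone (hsq : ∀ q, 0 ≤ L (q ^ 2)) (hb : ∀ n, |L (X ^ n)| ≤ 1)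
    {p : ℝ[X]} (hp : p ∈ intervalCone) : 0 ≤ L p := by
  rw [intervalCone, Subsemiring.mem_closure_iff] at hp
  induction hp using AddSubmonoid.closure_induction with
  | zero => simp
  | add p q _ _ hp hq =>
    rw [map_add]
    exact add_nonneg hp hq
  | mem p hp =>
    suffices ∃ q : ℝ[X], ∃ i j, p = q ^ 2 * (1 - X) ^ i * (1 + X) ^ j by
      obtain ⟨q, i, j, rfl⟩ := this
      exact apply_sq_mul_pow_mul_pow_nonneg hsq hb q i j
    induction hp using Submonoid.closure_induction with
    | mem p hp =>
      rcases hp with ⟨q, rfl⟩ | rfl | rfl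
      · exact ⟨q, 0, 0, by simp⟩
      · exact ⟨1, 1, 0, by simp⟩
      · exact ⟨1, 0, 1, by simp⟩
    | one => exact ⟨1, 0, 0, by simp⟩
    | mul p q _ _ hp hq =>
      obtain ⟨p, i, j, rfl⟩ := hp
      obtain ⟨q, k, l, rfl⟩ := hq
      exact ⟨p * q, i + k, j + l, by ring⟩

theorem apply_nonneg_of_eval_nonneg (hsq : ∀ q, 0 ≤ L (q ^ 2)) (hb : ∀ n, |L (X ^ n)| ≤ 1)
    {p : ℝ[X]} (hp : ∀ x ∈ Set.Icc (-1 : ℝ) 1, 0 ≤ p.eval x) : 0 ≤ L p := by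
  refine le_of_forall_pos_le_add fun ε hε => ?_
  have h := apply_nonneg_of_mem_intervalCone hsq hb (p := p + C ε)
    (mem_intervalCone_of_pos fun x hx => by
      rw [eval_add, eval_C]
      linarith [hp x hx])
  have h1 := (abs_le.1 (hb 0)).2
  rw [pow_zero] at h1
  rw [← mul_one (C ε), ← smul_eq_C_mul, map_add, map_smul, smul_eq_mul] at h
  nlinarith

end functional

end Polynomial

/-! ### Existence and uniqueness of the measure on `[-1, 1]` -/

open MeasureTheory CompactlySupported in
/-- A linear functional on `ℝ[X]` that is nonnegative on the polynomials that are nonnegative on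
`[-1, 1]` is given by a measure on `[-1, 1]`. -/
theorem Polynomial.exists_probabilityMeasure_of_nonneg {L : Polynomial ℝ →ₗ[ℝ] ℝ} (h1 : L 1 = 1)
    (hL : ∀ p : Polynomial ℝ, (∀ x ∈ Set.Icc (-1 : ℝ) 1, 0 ≤ p.eval x) → 0 ≤ L p) :
    ∃ μ : ProbabilityMeasure (Set.Icc (-1 : ℝ) 1), ∀ p : Polynomial ℝ,
      ∫ s : Set.Icc (-1 : ℝ) 1, p.eval (s : ℝ) ∂(μ : Measure (Set.Icc (-1 : ℝ) 1)) = L p := by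
  let ι : Polynomial ℝ →ₗ[ℝ] C(Set.Icc (-1 : ℝ) 1, ℝ) :=
    (Polynomial.toContinuousMapOnAlgHom (Set.Icc (-1 : ℝ) 1)).toLinearMap
  have hιe : ∀ p s, ι p s = p.eval (s : ℝ) := fun p s => rfl
  have hι : Function.Injective ι := fun p q hpq => by
    refine Polynomial.eq_of_infinite_eval_eq p q
      ((Set.Icc_infinite (by norm_num : (-1 : ℝ) < 1)).mono fun x hx => ?_)
    exact DFunLike.congr_fun hpq (⟨x, hx⟩ : Set.Icc (-1 : ℝ) 1)
  -- A polynomial is determined by its restriction to `[-1, 1]`, so `L` transfers to the subspace of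
  -- restrictions.
  let e := LinearEquiv.ofInjective ι hι
  have he : ∀ p, e.symm ⟨ι p, p, rfl⟩ = p := fun p => e.symm_apply_apply p
  obtain ⟨g, hg, hg0⟩ := riesz_extension (PointedCone.positive ℝ C(Set.Icc (-1 : ℝ) 1, ℝ))
    ⟨LinearMap.range ι, L ∘ₗ e.symm.toLinearMap⟩ (by
      rintro ⟨_, p, rfl⟩ hp
      rw [PointedCone.mem_positive] at hp
      change 0 ≤ L (e.symm ⟨ι p, p, rfl⟩)
      rw [he]
      exact hL p fun x hx => hp (⟨x, hx⟩ : Set.Icc (-1 : ℝ) 1)) (fun y => by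
      -- Riesz extension needs a polynomial that makes its sum with `y` nonnegative; the constant
      -- `‖y‖` does.
      refine ⟨⟨ι (Polynomial.C ‖y‖), _, rfl⟩, ?_⟩
      rw [PointedCone.mem_positive]
      intro s
      have := (abs_le.1 (y.norm_coe_le_norm s)).1
      change 0 ≤ Polynomial.eval (s : ℝ) (Polynomial.C ‖y‖) + y s
      rw [Polynomial.eval_C]
      linarith)
  have hgp : ∀ p, g (ι p) = L p := fun p => (hg ⟨ι p, p, rfl⟩).trans (congrArg L (he p))
  let Λ : C_c(Set.Icc (-1 : ℝ) 1, ℝ) →ₚ[ℝ] ℝ :=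
    { toFun h := g h.toContinuousMap
      map_add' h h' := map_add g h.toContinuousMap h'.toContinuousMap
      map_smul' c h := map_smul g c h.toContinuousMap
      monotone' h h' hh := by
        have := hg0 (h'.toContinuousMap - h.toContinuousMap) fun s => sub_nonneg.2 (hh s)
        rw [map_sub] at this
        exact sub_nonneg.1 this }
  have hint : ∀ p : Polynomial ℝ,
      ∫ s : Set.Icc (-1 : ℝ) 1, p.eval (s : ℝ) ∂(RealRMK.rieszMeasure Λ) = L p := fun p =>
    (RealRMK.integral_rieszMeasure Λ (CompactlySupportedContinuousMap.continuousMapEquiv (ι p))).trans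
      (hgp p)
  have hprob : IsProbabilityMeasure (RealRMK.rieszMeasure Λ) := by
    have := hint 1
    simp only [Polynomial.eval_one, integral_const, smul_eq_mul, mul_one, h1] at this
    refine ⟨?_⟩
    rwa [measureReal_def, ENNReal.toReal_eq_one_iff] at this
  exact ⟨⟨RealRMK.rieszMeasure Λ, hprob⟩, hint⟩

open MeasureTheory in
-- Moments fix the integrals of polynomials, and these form an algebra that separates points.
theorem MeasureTheory.ProbabilityMeasure.eq_of_forall_integral_pow_eq
    {μ ν : ProbabilityMeasure (Set.Icc (-1 : ℝ) 1)}
    (h : ∀ n : ℕ, ∫ s : Set.Icc (-1 : ℝ) 1, (s : ℝ) ^ n ∂(μ : Measure (Set.Icc (-1 : ℝ) 1)) =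
      ∫ s : Set.Icc (-1 : ℝ) 1, (s : ℝ) ^ n ∂(ν : Measure (Set.Icc (-1 : ℝ) 1))) : μ = ν := by
  have hint : ∀ (ρ : ProbabilityMeasure (Set.Icc (-1 : ℝ) 1)) (g : C(Set.Icc (-1 : ℝ) 1, ℝ)),
      Integrable g (ρ : Measure (Set.Icc (-1 : ℝ) 1)) := fun ρ g =>
    (BoundedContinuousFunction.mkOfCompact g).integrable _
  have hpoly : ∀ p : Polynomial ℝ,
      ∫ s : Set.Icc (-1 : ℝ) 1, p.eval (s : ℝ) ∂(μ : Measure (Set.Icc (-1 : ℝ) 1)) =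
        ∫ s : Set.Icc (-1 : ℝ) 1, p.eval (s : ℝ) ∂(ν : Measure (Set.Icc (-1 : ℝ) 1)) := fun p => by
    induction p using Polynomial.induction_on' with
    | add p q hp hq =>
      have hadd : ∀ ρ : ProbabilityMeasure (Set.Icc (-1 : ℝ) 1),
          ∫ s : Set.Icc (-1 : ℝ) 1, (p + q).eval (s : ℝ) ∂(ρ : Measure (Set.Icc (-1 : ℝ) 1)) =
            ∫ s : Set.Icc (-1 : ℝ) 1, p.eval (s : ℝ) ∂(ρ : Measure (Set.Icc (-1 : ℝ) 1)) +
            ∫ s : Set.Icc (-1 : ℝ) 1, q.eval (s : ℝ) ∂(ρ : Measure (Set.Icc (-1 : ℝ) 1)) :=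
        fun ρ => by
          simp only [Polynomial.eval_add]
          exact integral_add (hint ρ (p.toContinuousMapOn _)) (hint ρ (q.toContinuousMapOn _))
      rw [hadd, hadd, hp, hq]
    | monomial n a =>
      simp only [Polynomial.eval_monomial, integral_const_mul, h n]
  let P : StarSubalgebra ℝ C(Set.Icc (-1 : ℝ) 1, ℝ) :=
    { polynomialFunctions (Set.Icc (-1 : ℝ) 1) with star_mem' := fun {f} hf => by simpa using hf }
  let A : StarSubalgebra ℝ (BoundedContinuousFunction (Set.Icc (-1 : ℝ) 1) ℝ) :=
    P.comap (BoundedContinuousFunction.toContinuousMapStarₐ ℝ)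
  refine Subtype.ext ?_
  have : IsProbabilityMeasure μ.val := μ.2
  have : IsProbabilityMeasure ν.val := ν.2
  refine ext_of_forall_mem_subalgebra_integral_eq_of_polish (𝕜 := ℝ) (A := A) ?_ ?_
  · intro x y hxy
    obtain ⟨_, ⟨f, hf, rfl⟩, hfxy⟩ := polynomialFunctions_separatesPoints _ hxy
    exact ⟨f, ⟨f, ⟨BoundedContinuousFunction.mkOfCompact f, hf, rfl⟩, rfl⟩, hfxy⟩
  · rintro g ⟨p, -, hp⟩
    have : ∀ s, g s = p.eval (s : ℝ) := fun s => (DFunLike.congr_fun hp s).symm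
    simp only [this]
    exact hpoly p

/-! ### Complex coefficients, and from the measure to positive definiteness -/

open scoped ComplexOrder in
/-- A real symmetric positive semidefinite kernel is positive definite with complex coefficients. -/
theorem Matrix.PosSemidef.complex_sum_nonneg {ι : Type*} [Fintype ι] {A : Matrix ι ι ℝ}
    (hA : A.PosSemidef) (c : ι → ℂ) :
    0 ≤ ∑ j, ∑ k, c j * (starRingEnd ℂ) (c k) * (A j k : ℂ) := by
  have hq : ∀ v : ι → ℝ, 0 ≤ ∑ j, ∑ k, v j * v k * A j k := fun v => by
    have := hA.dotProduct_mulVec_nonneg v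
    simp only [dotProduct, mulVec, Finset.mul_sum, star_trivial] at this
    refine this.trans_eq (Finset.sum_congr rfl fun j _ => Finset.sum_congr rfl fun k _ => by ring)
  have hsymm : ∀ j k, A j k = A k j := fun j k => by
    simpa using congrFun (congrFun hA.1 k) j
  rw [Complex.nonneg_iff]
  simp only [Complex.re_sum, Complex.im_sum]
  constructor
  · have := add_nonneg (hq fun j => (c j).re) (hq fun j => (c j).im)
    simp only [← Finset.sum_add_distrib] at this
    refine this.trans_eq (Finset.sum_congr rfl fun j _ => Finset.sum_congr rfl fun k _ => ?_)
    simp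
    ring
  -- Symmetry of `A` cancels the two halves of the imaginary part.
  · have hanti : ∑ j, ∑ k, (c j).im * (c k).re * A j k = ∑ j, ∑ k, (c j).re * (c k).im * A j k := by
      rw [Finset.sum_comm]
      refine Finset.sum_congr rfl fun j _ => Finset.sum_congr rfl fun k _ => ?_
      rw [hsymm k j]
      ring
    have : ∑ j, ∑ k, (c j * (starRingEnd ℂ) (c k) * (A j k : ℂ)).im =
        ∑ j, ∑ k, (c j).im * (c k).re * A j k - ∑ j, ∑ k, (c j).re * (c k).im * A j k := by
      simp only [← Finset.sum_sub_distrib]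
      refine Finset.sum_congr rfl fun j _ => Finset.sum_congr rfl fun k _ => ?_
      simp
      ring
    rw [this, hanti, sub_self]

open MeasureTheory in
theorem IsL2Representing.isPositiveDefinite {φ : FreeGroup ℕ → ℂ}
    {μ : ProbabilityMeasure (Set.Icc (-1 : ℝ) 1)} (h : IsL2Representing μ φ) :
    IsPositiveDefinite φ := by
  intro n x c
  have hint : ∀ m : ℕ, Integrable (fun s : Set.Icc (-1 : ℝ) 1 => (s : ℝ) ^ m)
      (μ : Measure (Set.Icc (-1 : ℝ) 1)) := fun m =>
    (BoundedContinuousFunction.mkOfCompact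
      (⟨fun s : Set.Icc (-1 : ℝ) 1 => (s : ℝ) ^ m, by fun_prop⟩ : C(_, ℝ))).integrable _
  have hA : (of fun j k => ∫ s : Set.Icc (-1 : ℝ) 1, (s : ℝ) ^ l2LengthSq ((x j)⁻¹ * x k)
      ∂(μ : Measure (Set.Icc (-1 : ℝ) 1))).PosSemidef := by
    refine PosSemidef.of_dotProduct_mulVec_nonneg ?_ fun v => ?_
    · ext j k
      simp only [conjTranspose_apply, of_apply, star_trivial]
      rw [← l2LengthSq_inv]
      simp
    · have : star v ⬝ᵥ (of fun j k => ∫ s : Set.Icc (-1 : ℝ) 1, (s : ℝ) ^ l2LengthSq ((x j)⁻¹ * x k)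
          ∂(μ : Measure (Set.Icc (-1 : ℝ) 1))) *ᵥ v = ∫ s : Set.Icc (-1 : ℝ) 1, star v ⬝ᵥ
            (of fun j k => (s : ℝ) ^ l2LengthSq ((x j)⁻¹ * x k)) *ᵥ v
          ∂(μ : Measure (Set.Icc (-1 : ℝ) 1)) := by
        simp only [dotProduct, mulVec, of_apply]
        rw [integral_finsetSum _ fun j _ => (integrable_finsetSum _ fun k _ =>
          (hint _).mul_const _).const_mul _]
        refine Finset.sum_congr rfl fun j _ => ?_
        rw [integral_const_mul, integral_finsetSum _ fun k _ => (hint _).mul_const _]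
        simp only [integral_mul_const]
      rw [this]
      exact integral_nonneg fun s =>
        (posSemidef_pow_l2LengthSq (abs_le.2 s.2) x).dotProduct_mulVec_nonneg v
  simp only [h _]
  exact hA.complex_sum_nonneg c

/-! ### From positive definiteness to Hankel forms -/

/-- The blocks of a word of length `n` in distinct generators, whose first generator determines `n`
and `i`. -/
def freshWord (n i : ℕ) : List (ℕ × ℤ) :=
  (List.range n).map fun t => (Nat.pair n i + t, 1)

theorem sqSum_freshWord (n i : ℕ) : sqSum (freshWord n i) = n := by
  simp [sqSum, freshWord, Function.comp_def]

theorem isReducedBlocks_freshWord (n i : ℕ) : IsReducedBlocks (freshWord n i) := by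
  refine ⟨fun b hb => ?_, ?_⟩
  · obtain ⟨t, -, rfl⟩ := List.mem_map.1 hb
    exact one_ne_zero
  · rw [freshWord, List.isChain_map, List.isChain_iff_getElem]
    intro t ht
    simp

theorem fst_of_mem_head?_freshWord {n i : ℕ} {b : ℕ × ℤ} (hb : b ∈ (freshWord n i).head?) :
    b.1 = Nat.pair n i := by
  cases n with
  | zero => simp [freshWord] at hb
  | succ n =>
    simp [freshWord, List.range_succ_eq_map] at hb
    simp [← hb]

theorem l2LengthSq_freshWord (n i : ℕ) : l2LengthSq (blockProd (freshWord n i)) = n := by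
  rw [l2LengthSq_blockProd (isReducedBlocks_freshWord n i), sqSum_freshWord]

/-- Different first generators already exclude cancellation, even if later letters are shared. For
length `0` the words coincide, but they are empty and the formula persists. -/
theorem l2LengthSq_freshWord_inv_mul {p q : ℕ × ℕ} (hpq : p ≠ q) :
    l2LengthSq ((blockProd (freshWord p.1 p.2))⁻¹ * blockProd (freshWord q.1 q.2)) = p.1 + q.1 := by
  rw [l2LengthSq_inv_mul (isReducedBlocks_freshWord _ _) (isReducedBlocks_freshWord _ _),
    sqSum_freshWord, sqSum_freshWord]
  intro a ha b hb hab
  rw [fst_of_mem_head?_freshWord ha, fst_of_mem_head?_freshWord hb, Nat.pair_eq_pair] at hab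
  exact hpq (Prod.ext hab.1 hab.2)

open scoped ComplexOrder in
theorem IsPositiveDefinite.real_sum_nonneg {G : Type*} [Group G] {ψ : G → ℝ}
    (h : IsPositiveDefinite fun g => (ψ g : ℂ)) {ι : Type*} [Fintype ι] (x : ι → G) (c : ι → ℝ) :
    0 ≤ ∑ j, ∑ k, c j * c k * ψ ((x j)⁻¹ * x k) := by
  have e := Fintype.equivFin ι
  have := h _ (x ∘ e.symm) fun j => (c (e.symm j) : ℂ)
  simp only [Complex.conj_ofReal, Function.comp_apply, ← Complex.ofReal_mul,
    ← Complex.ofReal_sum] at this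
  rw [Complex.zero_le_real] at this
  refine this.trans_eq ?_
  rw [← e.symm.sum_comp]
  exact Finset.sum_congr rfl fun j _ => e.symm.sum_comp fun k =>
    c (e.symm j) * c k * ψ ((x (e.symm j))⁻¹ * x k)

open scoped ComplexOrder in
-- Radiality gives `φ g⁻¹ = φ g`, so the points `1, g` with coefficients `1, ±1` yield `2 ± 2 φ g ≥
-- 0`.
theorem IsPositiveDefinite.exists_eq_ofReal {φ : FreeGroup ℕ → ℂ} (h : IsPositiveDefinite φ)
    (hφ : IsL2Radial φ) (h1 : φ 1 = 1) (g : FreeGroup ℕ) : |(φ g).re| ≤ 1 ∧ φ g = (φ g).re := by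
  have hinv : φ g⁻¹ = φ g := hφ _ _ (by rw [l2Length, l2Length, l2LengthSq_inv])
  have hp := h 2 ![1, g] ![1, 1]
  have hm := h 2 ![1, g] ![1, -1]
  simp [Fin.sum_univ_two, h1, hinv, Complex.nonneg_iff] at hp hm
  refine ⟨abs_le.2 ⟨by linarith, by linarith⟩, Complex.ext rfl ?_⟩
  rw [Complex.ofReal_im]
  linarith

/-- A sequence `f` with `f (‖g‖₂²)` positive definite on the free group has positive semidefinite
Hankel matrices. -/
theorem sum_hankel_nonneg_of_isPositiveDefinite {f : ℕ → ℝ} (h0 : f 0 = 1)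
    (h : IsPositiveDefinite fun g => (f (l2LengthSq g) : ℂ)) (D : ℕ) (c : ℕ → ℝ) :
    0 ≤ ∑ n : Fin D, ∑ m : Fin D, c n * c m * f (n + m) := by
  set Q := ∑ n : Fin D, ∑ m : Fin D, c n * c m * f (n + m) with hQ
  -- `R` corrects the diagonal, where the kernel is `f 0 = 1` in place of `f (n + n)`.
  set R := ∑ n : Fin D, c n * c n * (1 - f (n + n)) with hR
  have key : ∀ N : ℕ, 0 ≤ N * (N * Q + R) := fun N => by
    have hN := h.real_sum_nonneg (fun p : Fin D × Fin N => blockProd (freshWord p.1 p.2))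
      fun p => c p.1
    have hval : ∀ p q : Fin D × Fin N,
        c p.1 * c q.1 * f (l2LengthSq
          ((blockProd (freshWord p.1 p.2))⁻¹ * blockProd (freshWord q.1 q.2))) =
        c p.1 * c q.1 * f (p.1 + q.1) +
          if p = q then c p.1 * c p.1 * (1 - f (p.1 + p.1)) else 0 := fun p q => by
      by_cases hpq : p = q
      · subst hpq
        simp [h0]
        ring
      · have := l2LengthSq_freshWord_inv_mul (p := ((p.1 : ℕ), (p.2 : ℕ)))
          (q := ((q.1 : ℕ), (q.2 : ℕ))) fun hh => by
            rw [Prod.mk.injEq] at hh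
            exact hpq (Prod.ext (Fin.ext hh.1) (Fin.ext hh.2))
        simp only at this
        rw [this, if_neg hpq, add_zero]
    simp only [hval, Finset.sum_add_distrib, Finset.sum_ite_eq, Finset.mem_univ, if_true] at hN
    refine hN.trans_eq ?_
    simp only [Fintype.sum_prod_type, Finset.sum_const, Finset.card_univ, Fintype.card_fin,
      nsmul_eq_mul, hQ, hR, ← Finset.mul_sum, mul_add]
  by_contra! hneg
  obtain ⟨N, hN⟩ := exists_nat_gt (R / -Q)
  rw [div_lt_iff₀ (neg_pos.2 hneg)] at hN
  have h2 : ((N + 1 : ℕ) : ℝ) * Q + R < 0 := by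
    push_cast
    linarith
  exact absurd (key (N + 1)) (not_le.2 (mul_neg_of_pos_of_neg (by positivity) h2))

/-! ### The moment problem and the equivalence -/

/-- Positive semidefinite Hankel matrices and boundedness characterize moment sequences on
`[-1, 1]`. -/
theorem exists_probabilityMeasure_of_hankel {f : ℕ → ℝ} (h0 : f 0 = 1) (hb : ∀ n, |f n| ≤ 1)
    (h : ∀ (D : ℕ) (c : ℕ → ℝ), 0 ≤ ∑ n : Fin D, ∑ m : Fin D, c n * c m * f (n + m)) :
    ∃ μ : MeasureTheory.ProbabilityMeasure (Set.Icc (-1 : ℝ) 1), ∀ n : ℕ,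
      ∫ s : Set.Icc (-1 : ℝ) 1, (s : ℝ) ^ n
        ∂(μ : MeasureTheory.Measure (Set.Icc (-1 : ℝ) 1)) = f n := by
  let L : Polynomial ℝ →ₗ[ℝ] ℝ := Polynomial.lsum fun n => f n • LinearMap.id
  have hX : ∀ n, L (Polynomial.X ^ n) = f n := fun n => by
    simp [L, Polynomial.lsum_apply, Polynomial.X_pow_eq_monomial]
  have hsq : ∀ q, 0 ≤ L (q ^ 2) := fun q => by
    -- `L (q²)` is the Hankel form at the coefficients of `q`.
    refine (h (q.natDegree + 1) q.coeff).trans_eq ?_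
    conv_rhs => rw [sq, q.as_sum_range, Finset.sum_mul_sum, map_sum]
    rw [← Fin.sum_univ_eq_sum_range fun n => L (∑ m ∈ Finset.range (q.natDegree + 1),
      Polynomial.monomial n (q.coeff n) * Polynomial.monomial m (q.coeff m))]
    refine Finset.sum_congr rfl fun n _ => ?_
    rw [map_sum, ← Fin.sum_univ_eq_sum_range fun m => L (Polynomial.monomial n (q.coeff n) *
      Polynomial.monomial m (q.coeff m))]
    refine Finset.sum_congr rfl fun m _ => ?_
    rw [Polynomial.monomial_mul_monomial, ← Polynomial.smul_X_eq_monomial, map_smul, hX,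
      smul_eq_mul]
  obtain ⟨μ, hμ⟩ := Polynomial.exists_probabilityMeasure_of_nonneg (L := L)
    (by simpa [h0] using hX 0) fun p hp =>
      Polynomial.apply_nonneg_of_eval_nonneg hsq (fun n => by rw [hX]; exact hb n) hp
  exact ⟨μ, fun n => by simpa [hX] using hμ (Polynomial.X ^ n)⟩

theorem theorem1p2 (φ : FreeGroup ℕ → ℂ) (hφ : IsL2Radial φ) (h1 : φ 1 = 1) :
    (IsPositiveDefinite φ ↔
      ∃ μ : MeasureTheory.ProbabilityMeasure (Set.Icc (-1 : ℝ) 1), IsL2Representing μ φ) ∧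
    (∀ μ ν : MeasureTheory.ProbabilityMeasure (Set.Icc (-1 : ℝ) 1),
      IsL2Representing μ φ → IsL2Representing ν φ → μ = ν) := by
  refine ⟨⟨fun h => ?_, fun ⟨μ, hμ⟩ => hμ.isPositiveDefinite⟩, fun μ ν hμ hν => ?_⟩
  · have hreal := h.exists_eq_ofReal hφ h1
    set f : ℕ → ℝ := fun n => (φ (blockProd (freshWord n 0))).re with hf
    have hφf : φ = fun g => (f (l2LengthSq g) : ℂ) := funext fun g => by
      rw [hf, ← (hreal _).2]
      exact hφ _ _ (by rw [l2Length, l2Length, l2LengthSq_freshWord])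
    have h0 : f 0 = 1 := by
      have := congrFun hφf 1
      rw [h1, l2LengthSq_one] at this
      exact_mod_cast this.symm
    obtain ⟨μ, hμ⟩ := exists_probabilityMeasure_of_hankel h0 (fun n => (hreal _).1)
      (sum_hankel_nonneg_of_isPositiveDefinite h0 (hφf ▸ h))
    exact ⟨μ, fun g => by rw [hμ, hφf]⟩
  · refine MeasureTheory.ProbabilityMeasure.eq_of_forall_integral_pow_eq fun n => ?_
    have := (hμ (blockProd (freshWord n 0))).symm.trans (hν _)
    rw [l2LengthSq_freshWord] at this
    exact_mod_cast this
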